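/- Let $U$ be a finite set and let $\mathcal I\subseteq 2^U$ be a non-empty downward-closed set system. Let $\mathcal P_{\mathcal I}\subseteq[0,1]^U$ be the convex hull of the indicator vectors of the inclusion-wise maximal sets of $\mathcal I$. A probability distribution $\mathcal D$ on $2^U$ satisfies Weak Negative Regression (WNR) if for every monotone $g:2^U\to\mathbb R$ and every $i\in U$ with $0<\Pr_{S\sim\mathcal D}[i\in S]<1$, \[ \mathbb E_{S\sim\mathcal D}[g(S\setminus\{i\})\mid i\in S]\le \mathbb E_{S\sim\mathcal D}[g(S\setminus\{i\})\mid i\notin S]. \] Assume that $\mathcal I$ admits WNR distributions: for every $\mathbf x\in\mathcal P_{\mathcal I}$ there is a WNR distribution supported on $\mathcal I$ with $\Pr[i\in S]=x_i$ for all $i\in U$. Let $f:2^U\to\mathbb R_{\ge 0}$ be monotone and submodular, let $p\in[0,1]^U$, and let $R\subseteq U$ be the random set that contains each $i\in U$ independently with probability $p_i$. Probing an item $i$ reveals whether $i\in R$. An adaptive algorithm is a (possibly randomized) procedure that probes items one after another, where each next item, or the decision to stop, may depend on the outcomes of the previous probes; the set $Q$ of probed items must always belong to $\mathcal I$, and the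 value of the algorithm is $\mathbb E[f(Q\cap R)]$. A non-adaptive algorithm chooses a (possibly random) set $Q\in\mathcal I$, independently of $R$, and probes exactly the items in $Q$; its value is again $\mathbb E[f(Q\cap R)]$. Then optimal adaptive and non-adaptive algorithms exist, and their values $\mathrm{OPT}_{\mathrm{ad}}$ and $\mathrm{OPT}_{\mathrm{non}}$ satisfy \[ \mathrm{OPT}_{\mathrm{ad}}\le \frac{e}{e-1}\,\mathrm{OPT}_{\mathrm{non}}, \] that is, the adaptivity gap $\mathrm{OPT}_{\mathrm{ad}}/\mathrm{OPT}_{\mathrm{non}}$ is at most $\frac{e}{e-1}$ (where the ratio is read as $0$ if $\mathrm{OPT}_{\mathrm{non}}=0$; then also $\mathrm{OPT}_{\mathrm{ad}}=0$). -/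

import Mathlib

namespace StochasticProbing

noncomputable section

/-- Expectation of a real function under a discrete probability distribution. -/
def expect {α : Type*} (D : PMF α) (g : α → ℝ) : ℝ :=
  ∑' a, (D a).toReal * g a

open Classical in
/-- Probability of an event. -/
def prob {α : Type*} (D : PMF α) (A : Set α) : ℝ :=
  expect D (fun a => if a ∈ A then 1 else 0)

open Classical in
/-- Conditional expectation `E[g | A]`, meaningful for events with `0 < prob D A`. -/
def condExpect {α : Type*} (D : PMF α) (A : Set α) (g : α → ℝ) : ℝ :=
  expect D (fun a => if a ∈ A then g a else 0) / prob D A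

section SetSystems

variable {U : Type*} [Fintype U] [DecidableEq U]

def Submodular (f : Finset U → ℝ) : Prop :=
  ∀ S T : Finset U, f (S ∪ T) + f (S ∩ T) ≤ f S + f T

/-- Weak Negative Regression. The inequality is required for every element `i` for which both
conditional expectations are defined, i.e. both conditioning events have positive probability. -/
def IsWNR (D : PMF (Finset U)) : Prop :=
  ∀ (i : U) (f : Finset U → ℝ), Monotone f →
    0 < prob D {S | i ∈ S} → 0 < prob D {S | i ∉ S} →
      condExpect D {S | i ∈ S} (fun S => f (S.erase i)) ≤
        condExpect D {S | i ∉ S} (fun S => f (S.erase i))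

/-- Indicator vector of a set. -/
def indicatorVec (S : Finset U) : U → ℝ := fun i => if i ∈ S then 1 else 0

/-- The convex hull of the indicator vectors of the (inclusion-wise) maximal sets of `I`. -/
def polytope (I : Set (Finset U)) : Set (U → ℝ) :=
  convexHull ℝ (indicatorVec '' {S | Maximal (· ∈ I) S})

/-- Every point of the polytope is the vector of marginals of some WNR distribution over `I`. -/
def AdmitsWNR (I : Set (Finset U)) : Prop :=
  ∀ x ∈ polytope I, ∃ D : PMF (Finset U),
    (∀ S ∈ D.support, S ∈ I) ∧ IsWNR D ∧ ∀ i, prob D {S | i ∈ S} = x i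

/-- Expectation of `g R`, where the random set `R` of non-empty (active) items contains each `i`
independently with probability `p i`. -/
def expectItems (p : U → ℝ) (g : Finset U → ℝ) : ℝ :=
  ∑ R : Finset U, ((∏ i ∈ R, p i) * ∏ i ∈ Rᶜ, (1 - p i)) * g R

/-- Deterministic adaptive algorithms: stop, or probe an item and continue depending on whether
it turned out to be active or empty. -/
inductive DecisionTree (U : Type*) : Type _
  | done : DecisionTree U
  | probe (i : U) (ifActive ifEmpty : DecisionTree U) : DecisionTree U

/-- The set of items probed by a decision tree when `R` is the set of active items. -/
def DecisionTree.probed : DecisionTree U → Finset U → Finset U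
  | .done, _ => ∅
  | .probe i A B, R => insert i (if i ∈ R then A.probed R else B.probed R)

/-- Whatever the realization, the set of probed items lies in `I`. -/
def DecisionTree.Feasible (I : Set (Finset U)) (T : DecisionTree U) : Prop :=
  ∀ R : Finset U, T.probed R ∈ I

/-- Expected value of `f` on the elements contained in the probed items. -/
def DecisionTree.value (f : Finset U → ℝ) (p : U → ℝ) (T : DecisionTree U) : ℝ :=
  expectItems p (fun R => f (T.probed R ∩ R))

/-- Expected value of `f` when exactly the items of the fixed set `S` are probed. -/
def setValue (f : Finset U → ℝ) (p : U → ℝ) (S : Finset U) : ℝ :=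
  expectItems p (fun R => f (S ∩ R))

/-- The values of all (randomized) adaptive algorithms that always probe a set in `I`. -/
def adaptiveValues (I : Set (Finset U)) (f : Finset U → ℝ) (p : U → ℝ) : Set ℝ :=
  {v | ∃ A : PMF (DecisionTree U), (∀ T ∈ A.support, T.Feasible I) ∧
    v = expect A (DecisionTree.value f p)}

/-- The values of all (randomized) non-adaptive algorithms: sample a set of `I` and probe it. -/
def nonadaptiveValues (I : Set (Finset U)) (f : Finset U → ℝ) (p : U → ℝ) : Set ℝ :=
  {v | ∃ A : PMF (Finset U), (∀ S ∈ A.support, S ∈ I) ∧ v = expect A (setValue f p)}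

def adaptiveOpt (I : Set (Finset U)) (f : Finset U → ℝ) (p : U → ℝ) : ℝ :=
  sSup (adaptiveValues I f p)

def nonadaptiveOpt (I : Set (Finset U)) (f : Finset U → ℝ) (p : U → ℝ) : ℝ :=
  sSup (nonadaptiveValues I f p)

/-- The ratio of the two optima (with value `0` if the non-adaptive optimum is `0`). -/
def adaptivityGap (I : Set (Finset U)) (f : Finset U → ℝ) (p : U → ℝ) : ℝ :=
  adaptiveOpt I f p / nonadaptiveOpt I f p

end SetSystems

end

end StochasticProbing

/-! A decision tree `T` probes a set contained in a random maximal set of `I`, whose vector of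
marginals `x` lies in the polytope. Let `D` be a WNR distribution on `I` with marginals `x`, and let
`G S = E[f (S ∩ R)]`. Three facts combine.

* Whether `T` probes `i` is independent of whether `i` is active, so submodularity bounds the value
  of `T` by `G Z + ∑ i, x i * (G (Z ∪ {i}) - G (Z \ {i}))`, for every fixed set `Z`.
* If `F` is the multilinear extension of `G`, averaging this bound over an independent random set
  with marginals `t • x` gives `value T ≤ φ + dφ/dt` for `φ t = F (t • x)`; integrating over
  `[0, 1]` yields `(e - 1) * value T + f ∅ ≤ e * F x`.
* Under WNR, replacing the items of `S ∼ D` one at a time by independent ones never increases the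
  expectation of a submodular function; hence `F x ≤ E[G S]`, the value of probing `S ∼ D`.
-/

namespace StochasticProbing

section DiscreteDeriv

variable {U : Type*} [DecidableEq U]

/-- The marginal value of the item `i` for the set function `f`, as a function of the other items:
`S` is first made to avoid `i`, so that the value does not depend on whether `i ∈ S`. -/
def discreteDeriv (f : Finset U → ℝ) (i : U) (S : Finset U) : ℝ :=
  f (insert i S) - f (S.erase i)

lemma discreteDeriv_erase (f : Finset U → ℝ) (i : U) (S : Finset U) :
    discreteDeriv f i (S.erase i) = discreteDeriv f i S := by
  have h_insert : insert i (S.erase i) = insert i S := by grind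
  rw [discreteDeriv, h_insert, Finset.erase_idem, discreteDeriv]

lemma erase_add_indicator_discreteDeriv (f : Finset U → ℝ) (i : U) (S : Finset U) :
    f (S.erase i) + {S | i ∈ S}.indicator (discreteDeriv f i) S = f S := by
  by_cases hS : i ∈ S <;> simp [discreteDeriv, hS]

lemma discreteDeriv_nonneg {f : Finset U → ℝ} (hf : Monotone f) (i : U) (S : Finset U) :
    0 ≤ discreteDeriv f i S :=
  sub_nonneg.2 (hf ((S.erase_subset i).trans (S.subset_insert i)))

lemma Submodular.antitone_discreteDeriv {f : Finset U → ℝ} (hf : Submodular f) (i : U) :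
    Antitone (discreteDeriv f i) := by
  intro S T hST
  have h := hf (insert i S) (T.erase i)
  have h_union : insert i S ∪ T.erase i = insert i T := by grind
  have h_inter : insert i S ∩ T.erase i = S.erase i := by grind
  rw [h_union, h_inter] at h
  unfold discreteDeriv
  linarith

lemma Submodular.union_le_add_sum_discreteDeriv {f : Finset U → ℝ} (hf : Submodular f)
    (hf_mono : Monotone f) (S T : Finset U) :
    f (S ∪ T) ≤ f S + ∑ i ∈ T, discreteDeriv f i S := by
  induction T using Finset.induction_on with
  | empty => simp
  | insert i T hi ih =>
    have h_anti : discreteDeriv f i (S ∪ T) ≤ discreteDeriv f i S :=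
      hf.antitone_discreteDeriv i Finset.subset_union_left
    have h_erase : f ((S ∪ T).erase i) ≤ f (S ∪ T) := hf_mono (Finset.erase_subset i _)
    rw [Finset.union_insert, Finset.sum_insert hi]
    unfold discreteDeriv at h_anti ih ⊢
    linarith

end DiscreteDeriv

section ExpectItems

variable {U : Type*} [Fintype U] [DecidableEq U]

/-- The probability that `R` is the set of active items, as a product over all items. -/
def weight (p : U → ℝ) (R : Finset U) : ℝ :=
  ∏ i, if i ∈ R then p i else 1 - p i

/-- The probability that `R` is the set of active items, up to the state of `i`: the factor of
`weight p R` that belongs to `i` is omitted. -/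
def weightOff (p : U → ℝ) (i : U) (R : Finset U) : ℝ :=
  ∏ j ∈ Finset.univ.erase i, if j ∈ R then p j else 1 - p j

lemma expectItems_eq_sum_weight (p : U → ℝ) (g : Finset U → ℝ) :
    expectItems p g = ∑ R, weight p R * g R := by
  refine Finset.sum_congr rfl fun R _ => ?_
  rw [weight, Finset.prod_ite]
  congr 3 <;> ext <;> simp

lemma weight_eq_mul_weightOff (p : U → ℝ) (i : U) (R : Finset U) :
    weight p R = (if i ∈ R then p i else 1 - p i) * weightOff p i R :=
  (Finset.mul_prod_erase _ _ (Finset.mem_univ i)).symm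

lemma weightOff_insert (p : U → ℝ) (i : U) (R : Finset U) :
    weightOff p i (insert i R) = weightOff p i R := by
  refine Finset.prod_congr rfl fun j hj => ?_
  simp only [Finset.mem_insert, Finset.ne_of_mem_erase hj, false_or]

lemma weight_nonneg {p : U → ℝ} (hp : ∀ i, p i ∈ Set.Icc (0 : ℝ) 1) (R : Finset U) :
    0 ≤ weight p R := by
  refine Finset.prod_nonneg fun i _ => ?_
  split_ifs
  · exact (hp i).1
  · exact sub_nonneg.2 (hp i).2

lemma sum_weight (p : U → ℝ) : ∑ R, weight p R = 1 := by
  calc ∑ R, weight p R = expectItems p fun _ => 1 := by simp [expectItems_eq_sum_weight]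
    _ = ∏ i, (p i + (1 - p i)) := by
      simp only [expectItems, mul_one, Finset.prod_add, Finset.powerset_univ,
        Finset.compl_eq_univ_sdiff]
    _ = 1 := by simp

lemma expectItems_const (p : U → ℝ) (c : ℝ) : expectItems p (fun _ => c) = c := by
  rw [expectItems_eq_sum_weight, ← Finset.sum_mul, sum_weight, one_mul]

lemma expectItems_mono {p : U → ℝ} (hp : ∀ i, p i ∈ Set.Icc (0 : ℝ) 1) {g h : Finset U → ℝ}
    (hgh : ∀ R, g R ≤ h R) : expectItems p g ≤ expectItems p h := by
  simp only [expectItems_eq_sum_weight]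
  exact Finset.sum_le_sum fun R _ => mul_le_mul_of_nonneg_left (hgh R) (weight_nonneg hp R)

lemma expectItems_add (p : U → ℝ) (g h : Finset U → ℝ) :
    expectItems p (fun R => g R + h R) = expectItems p g + expectItems p h := by
  simp only [expectItems, mul_add, Finset.sum_add_distrib]

lemma expectItems_sub (p : U → ℝ) (g h : Finset U → ℝ) :
    expectItems p (fun R => g R - h R) = expectItems p g - expectItems p h := by
  simp only [expectItems, mul_sub, Finset.sum_sub_distrib]

lemma expectItems_mul_left (p : U → ℝ) (c : ℝ) (g : Finset U → ℝ) :
    expectItems p (fun R => c * g R) = c * expectItems p g := by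
  simp only [expectItems, Finset.mul_sum, mul_left_comm c]

lemma expectItems_sum {ι : Type*} (s : Finset ι) (p : U → ℝ) (g : ι → Finset U → ℝ) :
    expectItems p (fun R => ∑ j ∈ s, g j R) = ∑ j ∈ s, expectItems p (g j) := by
  simp only [expectItems, Finset.mul_sum]
  exact Finset.sum_comm

lemma expectItems_zero_left (g : Finset U → ℝ) : expectItems 0 g = g ∅ := by
  rw [expectItems, Finset.sum_eq_single ∅]
  · simp
  · intro R _ hR
    simp [hR]
  · simp

lemma expectItems_mem_of_convex {p : U → ℝ} (hp : ∀ i, p i ∈ Set.Icc (0 : ℝ) 1) {ι : Type*}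
    {s : Set (ι → ℝ)} (hs : Convex ℝ s) {v : Finset U → ι → ℝ} (hv : ∀ R, v R ∈ s) :
    (fun j => expectItems p fun R => v R j) ∈ s := by
  have h := hs.sum_mem (t := Finset.univ) (fun R _ => weight_nonneg hp R) (sum_weight p)
    fun R _ => hv R
  refine Set.mem_of_eq_of_mem ?_ h
  funext j
  simp only [expectItems_eq_sum_weight, Finset.sum_apply, Pi.smul_apply, smul_eq_mul]

lemma sum_eq_sum_powerset_erase (i : U) (h : Finset U → ℝ) :
    ∑ R, h R = ∑ R ∈ (Finset.univ.erase i).powerset, (h R + h (insert i R)) := by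
  rw [Finset.sum_add_distrib, ← Finset.sum_powerset_insert (Finset.notMem_erase i _),
    Finset.insert_erase (Finset.mem_univ i), Finset.powerset_univ]

lemma sum_ite_mul_weightOff_mul (p : U → ℝ) (i : U) (a b : ℝ) (g : Finset U → ℝ) :
    ∑ R, (if i ∈ R then a else b) * weightOff p i R * g R =
      expectItems p fun R => a * g (insert i R) + b * g (R.erase i) := by
  rw [expectItems_eq_sum_weight, sum_eq_sum_powerset_erase i, sum_eq_sum_powerset_erase i]
  refine Finset.sum_congr rfl fun R hR => ?_
  have hi : i ∉ R := fun h => Finset.notMem_erase i _ (Finset.mem_powerset.1 hR h)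
  simp only [weight_eq_mul_weightOff p i, weightOff_insert, hi, Finset.mem_insert_self, if_true,
    if_false, Finset.insert_idem, Finset.erase_insert hi, Finset.erase_eq_of_notMem hi]
  ring

lemma expectItems_eq_expectItems_erase_add (p : U → ℝ) (i : U) (g : Finset U → ℝ) :
    expectItems p g = expectItems p fun R => g (R.erase i) + p i * discreteDeriv g i R := by
  rw [expectItems_eq_sum_weight]
  simp only [weight_eq_mul_weightOff p i]
  rw [sum_ite_mul_weightOff_mul]
  congr 1
  funext R
  unfold discreteDeriv
  ring

lemma hasDerivAt_expectItems_smul (y : U → ℝ) (f : Finset U → ℝ) (t : ℝ) :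
    HasDerivAt (fun s : ℝ => expectItems (s • y) f)
      (∑ i, y i * expectItems (t • y) (discreteDeriv f i)) t := by
  have h_factor (R : Finset U) (i : U) : HasDerivAt
      (fun s : ℝ => if i ∈ R then (s • y) i else 1 - (s • y) i)
      (if i ∈ R then y i else -y i) t := by
    have h : HasDerivAt (fun s : ℝ => (s • y) i) (y i) t := by
      simpa using (hasDerivAt_id t).mul_const (y i)
    split_ifs
    · exact h
    · exact h.const_sub 1
  have h_weight (R : Finset U) : HasDerivAt (fun s : ℝ => weight (s • y) R)
      (∑ i, (if i ∈ R then y i else -y i) * weightOff (t • y) i R) t :=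
    (HasDerivAt.fun_finsetProd fun i _ => h_factor R i).congr_deriv
      (Finset.sum_congr rfl fun i _ => mul_comm _ _)
  simp only [expectItems_eq_sum_weight _ f]
  refine (HasDerivAt.fun_sum fun R _ => (h_weight R).mul_const (f R)).congr_deriv ?_
  simp only [Finset.sum_mul]
  rw [Finset.sum_comm]
  refine Finset.sum_congr rfl fun i _ => ?_
  rw [sum_ite_mul_weightOff_mul, ← expectItems_mul_left]
  congr 1
  funext R
  unfold discreteDeriv
  ring

end ExpectItems

section CorrelationGap

variable {U : Type*} [Fintype U] [DecidableEq U]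

lemma monotoneOn_exp_mul_sub {s : Set ℝ} (hs : Convex ℝ s) {φ φ' : ℝ → ℝ}
    (hφ : ∀ t, HasDerivAt φ (φ' t) t) {V : ℝ} (hV : ∀ t ∈ s, V ≤ φ t + φ' t) :
    MonotoneOn (fun t => Real.exp t * (φ t - V)) s := by
  have h_deriv (t : ℝ) : HasDerivAt (fun t => Real.exp t * (φ t - V))
      (Real.exp t * (φ t - V) + Real.exp t * φ' t) t :=
    (Real.hasDerivAt_exp t).mul ((hφ t).sub_const V)
  refine monotoneOn_of_deriv_nonneg hs
    (fun t _ => (h_deriv t).continuousAt.continuousWithinAt)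
    (fun t _ => (h_deriv t).differentiableAt.differentiableWithinAt) fun t ht => ?_
  rw [(h_deriv t).deriv, ← mul_add]
  exact mul_nonneg (Real.exp_pos t).le (by linarith [hV t (interior_subset ht)])

lemma le_expectItems_add_sum_of_forall_le {f : Finset U → ℝ} {q : U → ℝ}
    (hq : ∀ i, q i ∈ Set.Icc (0 : ℝ) 1) {y : U → ℝ} {V : ℝ}
    (hV : ∀ S, V ≤ f S + ∑ i, y i * discreteDeriv f i S) :
    V ≤ expectItems q f + ∑ i, y i * expectItems q (discreteDeriv f i) := by
  calc V = expectItems q fun _ => V := (expectItems_const q V).symm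
    _ ≤ expectItems q fun S => f S + ∑ i, y i * discreteDeriv f i S := expectItems_mono hq hV
    _ = expectItems q f + ∑ i, y i * expectItems q (discreteDeriv f i) := by
      simp only [expectItems_add, expectItems_sum, expectItems_mul_left]

lemma exp_sub_one_mul_add_le_expectItems {f : Finset U → ℝ} {y : U → ℝ}
    (hy : ∀ i, y i ∈ Set.Icc (0 : ℝ) 1) {V : ℝ}
    (hV : ∀ S, V ≤ f S + ∑ i, y i * discreteDeriv f i S) :
    (Real.exp 1 - 1) * V + f ∅ ≤ Real.exp 1 * expectItems y f := by
  have h_ray (t : ℝ) (ht : t ∈ Set.Icc (0 : ℝ) 1) (i : U) : (t • y) i ∈ Set.Icc (0 : ℝ) 1 :=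
    ⟨mul_nonneg ht.1 (hy i).1, mul_le_one₀ ht.2 (hy i).1 (hy i).2⟩
  have h_mono := monotoneOn_exp_mul_sub (convex_Icc 0 1) (hasDerivAt_expectItems_smul y f)
    fun t ht => le_expectItems_add_sum_of_forall_le (h_ray t ht) hV
  have h := h_mono (Set.left_mem_Icc.2 zero_le_one) (Set.right_mem_Icc.2 zero_le_one) zero_le_one
  simp only [Real.exp_zero, zero_smul, one_smul, expectItems_zero_left] at h
  linarith

end CorrelationGap

section Expect

variable {α : Type*}

lemma hasSum_toReal (D : PMF α) : HasSum (fun a => (D a).toReal) 1 := by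
  have h := ENNReal.hasSum_toReal D.tsum_coe_ne_top
  rwa [← ENNReal.tsum_toReal_eq D.apply_ne_top, D.tsum_coe, ENNReal.toReal_one] at h

lemma expect_const (D : PMF α) (c : ℝ) : expect D (fun _ => c) = c :=
  ((hasSum_toReal D).mul_right c).tsum_eq.trans (one_mul c)

lemma expect_nonneg (D : PMF α) {g : α → ℝ} (hg : ∀ a, 0 ≤ g a) : 0 ≤ expect D g :=
  tsum_nonneg fun a => mul_nonneg ENNReal.toReal_nonneg (hg a)

lemma expect_pure (a : α) (g : α → ℝ) : expect (PMF.pure a) g = g a := by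
  rw [expect, tsum_eq_single a fun b hb => by simp [PMF.pure_apply, hb]]
  simp [PMF.pure_apply]

lemma expect_neg (D : PMF α) (g : α → ℝ) : expect D (fun a => -g a) = -expect D g := by
  simp only [expect, mul_neg, tsum_neg]

lemma expect_mul_left (D : PMF α) (c : ℝ) (g : α → ℝ) :
    expect D (fun a => c * g a) = c * expect D g := by
  simp only [expect, mul_left_comm _ c, tsum_mul_left]

lemma expect_add {D : PMF α} {g h : α → ℝ} (hg : Summable fun a => (D a).toReal * g a)
    (hh : Summable fun a => (D a).toReal * h a) :
    expect D (fun a => g a + h a) = expect D g + expect D h := by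
  simp only [expect, mul_add, hg.tsum_add hh]

lemma expect_le_of_forall_le {D : PMF α} {g : α → ℝ}
    (hg : Summable fun a => (D a).toReal * g a) {c : ℝ} (hc : ∀ a ∈ D.support, g a ≤ c) :
    expect D g ≤ c := by
  rw [← expect_const D c]
  refine hg.tsum_le_tsum (fun a => ?_) ((hasSum_toReal D).mul_right c).summable
  by_cases ha : D a = 0
  · simp [ha]
  · exact mul_le_mul_of_nonneg_left (hc a ((D.mem_support_iff a).2 ha)) ENNReal.toReal_nonneg

lemma summable_toReal_mul_of_isBounded (D : PMF α) {g : α → ℝ}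
    (hg : Bornology.IsBounded (Set.range g)) : Summable fun a => (D a).toReal * g a := by
  obtain ⟨K, hK⟩ := hg.exists_norm_le
  refine Summable.of_norm_bounded ((hasSum_toReal D).summable.mul_right K) fun a => ?_
  rw [norm_mul, Real.norm_of_nonneg ENNReal.toReal_nonneg]
  exact mul_le_mul_of_nonneg_left (hK _ ⟨a, rfl⟩) ENNReal.toReal_nonneg

lemma isGreatest_sSup_expect {P : α → Prop} (hP : ∃ a, P a) {g : α → ℝ}
    (hg : (Set.range g).Finite) :
    IsGreatest {w | ∃ A : PMF α, (∀ a ∈ A.support, P a) ∧ w = expect A g}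
      (sSup {w | ∃ A : PMF α, (∀ a ∈ A.support, P a) ∧ w = expect A g}) := by
  obtain ⟨b, hb⟩ := hP
  obtain ⟨_, ⟨a, ha, rfl⟩, h_max⟩ := Set.exists_max_image (g '' {a | P a}) id
    (hg.subset (Set.image_subset_range _ _)) ⟨g b, b, hb, rfl⟩
  have h_greatest :
      IsGreatest {w | ∃ A : PMF α, (∀ a ∈ A.support, P a) ∧ w = expect A g} (g a) := by
    refine ⟨⟨PMF.pure a, by simpa using ha, (expect_pure a g).symm⟩, ?_⟩
    rintro _ ⟨A, hA, rfl⟩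
    exact expect_le_of_forall_le (summable_toReal_mul_of_isBounded A hg.isBounded)
      fun c hc => h_max _ ⟨c, hA c hc, rfl⟩
  exact h_greatest.csSup_eq.symm ▸ h_greatest

lemma prob_nonneg (D : PMF α) (A : Set α) : 0 ≤ prob D A :=
  expect_nonneg D fun a => by split_ifs <;> simp

lemma expect_indicator_add_expect_indicator_compl {D : PMF α} {g : α → ℝ}
    (hg : Summable fun a => (D a).toReal * g a) (A : Set α) :
    expect D (A.indicator g) + expect D (Aᶜ.indicator g) = expect D g := by
  have h_indicator (B : Set α) : Summable fun a => (D a).toReal * B.indicator g a :=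
    (hg.indicator B).congr fun _ => Set.indicator_mul_right B (fun a => (D a).toReal) g
  rw [← expect_add (h_indicator A) (h_indicator Aᶜ)]
  exact congrArg (expect D) (Set.indicator_self_add_compl A g)

lemma prob_add_prob_compl (D : PMF α) (A : Set α) : prob D A + prob D Aᶜ = 1 :=
  (expect_indicator_add_expect_indicator_compl ((hasSum_toReal D).summable.mul_right 1) A).trans
    (expect_const D 1)

lemma prob_mem_Icc (D : PMF α) (A : Set α) : prob D A ∈ Set.Icc (0 : ℝ) 1 :=
  ⟨prob_nonneg D A, by linarith [prob_add_prob_compl D A, prob_nonneg D Aᶜ]⟩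

lemma expect_indicator_eq_zero_of_prob_eq_zero {D : PMF α} {A : Set α} (hA : prob D A = 0)
    (g : α → ℝ) : expect D (A.indicator g) = 0 := by
  have h_summable : Summable (A.indicator fun a => (D a).toReal) :=
    (hasSum_toReal D).summable.indicator A
  have h_sum : ∑' a, A.indicator (fun a => (D a).toReal) a = 0 := by
    simpa only [prob, expect, mul_ite, mul_one, mul_zero] using! hA
  have h_zero : A.indicator (fun a => (D a).toReal) = 0 :=
    (hasSum_zero_iff_of_nonneg (Set.indicator_nonneg fun _ _ => ENNReal.toReal_nonneg)).1
      (h_sum ▸ h_summable.hasSum)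
  have h_term (a : α) : (D a).toReal * A.indicator g a = 0 := by
    rw [← Set.indicator_mul_right A (fun a => (D a).toReal) g, Set.indicator_mul_left, h_zero,
      Pi.zero_apply, zero_mul]
  simp only [expect, h_term, tsum_zero]

lemma expect_indicator_le_of_condExpect_le {D : PMF α} {A : Set α} {g : α → ℝ}
    (hg : Summable fun a => (D a).toReal * g a)
    (h : 0 < prob D A → 0 < prob D Aᶜ → condExpect D A g ≤ condExpect D Aᶜ g) :
    expect D (A.indicator g) ≤ prob D A * expect D g := by
  have h_split := expect_indicator_add_expect_indicator_compl hg A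
  have h_compl : prob D Aᶜ = 1 - prob D A := by linarith [prob_add_prob_compl D A]
  rcases (prob_nonneg D A).eq_or_lt with hA | hA
  · rw [expect_indicator_eq_zero_of_prob_eq_zero hA.symm, ← hA, zero_mul]
  rcases (prob_nonneg D Aᶜ).eq_or_lt with hAc | hAc
  · rw [expect_indicator_eq_zero_of_prob_eq_zero hAc.symm] at h_split
    rw [show prob D A = 1 by linarith, one_mul, ← h_split, add_zero]
  have h_div : expect D (A.indicator g) / prob D A ≤ expect D (Aᶜ.indicator g) / prob D Aᶜ :=
    h hA hAc
  rw [div_le_div_iff₀ hA hAc, h_compl] at h_div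
  rw [← h_split]
  linarith

end Expect

section SubmodularDominance

variable {U : Type*} [DecidableEq U]

section OneItem

variable [Finite U]

lemma IsWNR.prob_mul_expect_discreteDeriv_le {D : PMF (Finset U)} (hD : IsWNR D)
    {g : Finset U → ℝ} (hg : Submodular g) (i : U) :
    prob D {S | i ∈ S} * expect D (discreteDeriv g i) ≤
      expect D ({S | i ∈ S}.indicator (discreteDeriv g i)) := by
  have h := expect_indicator_le_of_condExpect_le Summable.of_finite <|
    hD i (fun S => -discreteDeriv g i S) fun S T hST =>
      neg_le_neg (hg.antitone_discreteDeriv i hST)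
  simp only [discreteDeriv_erase] at h
  rw [Set.indicator_neg, expect_neg, expect_neg, mul_neg] at h
  exact neg_le_neg_iff.1 h

lemma IsWNR.expect_erase_add_le {D : PMF (Finset U)} (hD : IsWNR D) {g : Finset U → ℝ}
    (hg : Submodular g) (i : U) :
    expect D (fun S => g (S.erase i) + prob D {S | i ∈ S} * discreteDeriv g i S) ≤
      expect D g := by
  conv_rhs => rw [← funext (erase_add_indicator_discreteDeriv g i)]
  rw [expect_add Summable.of_finite Summable.of_finite,
    expect_add Summable.of_finite Summable.of_finite, expect_mul_left]
  exact add_le_add_right (hD.prob_mul_expect_discreteDeriv_le hg i) _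

end OneItem

variable [Fintype U]

/-- The expectation of `g` after the states of the items in `B` have been replaced by independent
ones with marginals `y`. It interpolates between `g` (for `B = ∅`) and the constant
`expectItems y g` (for `B = univ`). -/
def resample (y : U → ℝ) (B : Finset U) (g : Finset U → ℝ) (S : Finset U) : ℝ :=
  expectItems y fun T => g ((S \ B) ∪ (T ∩ B))

lemma resample_empty (y : U → ℝ) (g : Finset U → ℝ) : resample y ∅ g = g := by
  funext S
  simp only [resample, Finset.sdiff_empty, Finset.inter_empty, Finset.union_empty,
    expectItems_const]

lemma resample_univ (y : U → ℝ) (g : Finset U → ℝ) :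
    resample y Finset.univ g = fun _ => expectItems y g := by
  funext S
  simp [resample, Finset.sdiff_eq_empty_iff_subset.2 (Finset.subset_univ S)]

lemma resample_insert (y : U → ℝ) (g : Finset U → ℝ) {B : Finset U} {i : U} (hi : i ∉ B)
    (S : Finset U) : resample y (insert i B) g S =
      resample y B g (S.erase i) + y i * discreteDeriv (resample y B g) i S := by
  unfold resample discreteDeriv
  rw [expectItems_eq_expectItems_erase_add y i, ← expectItems_sub, ← expectItems_mul_left,
    ← expectItems_add]
  congr 1
  funext T
  have h_absent : (S \ insert i B) ∪ (T.erase i ∩ insert i B) = (S.erase i \ B) ∪ (T ∩ B) := by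
    grind
  have h_present : (S \ insert i B) ∪ (insert i T ∩ insert i B) = (insert i S \ B) ∪ (T ∩ B) := by
    grind
  simp only [discreteDeriv, h_absent, h_present]

lemma Submodular.resample {g : Finset U → ℝ} (hg : Submodular g) {y : U → ℝ}
    (hy : ∀ i, y i ∈ Set.Icc (0 : ℝ) 1) (B : Finset U) : Submodular (resample y B g) := by
  intro S S'
  unfold StochasticProbing.resample
  rw [← expectItems_add, ← expectItems_add]
  refine expectItems_mono hy fun T => ?_
  convert hg ((S \ B) ∪ (T ∩ B)) ((S' \ B) ∪ (T ∩ B)) using 3 <;> grind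

lemma IsWNR.expectItems_prob_le_expect {D : PMF (Finset U)} (hD : IsWNR D) {g : Finset U → ℝ}
    (hg : Submodular g) : expectItems (fun i => prob D {S | i ∈ S}) g ≤ expect D g := by
  set y : U → ℝ := fun i => prob D {S | i ∈ S}
  have hy (i : U) : y i ∈ Set.Icc (0 : ℝ) 1 := prob_mem_Icc D _
  have h_resample (B : Finset U) : expect D (resample y B g) ≤ expect D g := by
    induction B using Finset.induction_on with
    | empty => rw [resample_empty]
    | insert i B hi ih =>
      rw [funext (resample_insert y g hi)]
      exact (hD.expect_erase_add_le (hg.resample hy B) i).trans ih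
  simpa only [resample_univ, expect_const] using h_resample Finset.univ

end SubmodularDominance

section SetValue

variable {U : Type*} [Fintype U] [DecidableEq U]

lemma setValue_empty (f : Finset U → ℝ) (p : U → ℝ) : setValue f p ∅ = f ∅ := by
  simp only [setValue, Finset.empty_inter, expectItems_const]

lemma setValue_nonneg {f : Finset U → ℝ} (hf : ∀ S, 0 ≤ f S) {p : U → ℝ}
    (hp : ∀ i, p i ∈ Set.Icc (0 : ℝ) 1) (S : Finset U) : 0 ≤ setValue f p S :=
  (expectItems_const p 0).symm.trans_le (expectItems_mono hp fun _ => hf _)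

lemma Submodular.setValue {f : Finset U → ℝ} (hf : Submodular f) {p : U → ℝ}
    (hp : ∀ i, p i ∈ Set.Icc (0 : ℝ) 1) : Submodular (setValue f p) := by
  intro S T
  unfold StochasticProbing.setValue
  rw [← expectItems_add, ← expectItems_add]
  refine expectItems_mono hp fun R => ?_
  rw [Finset.union_inter_distrib_right, Finset.inter_inter_distrib_right]
  exact hf (S ∩ R) (T ∩ R)

lemma discreteDeriv_setValue (f : Finset U → ℝ) (p : U → ℝ) (i : U) (S : Finset U) :
    discreteDeriv (setValue f p) i S =
      p i * expectItems p fun R => discreteDeriv f i (S ∩ R) := by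
  unfold setValue
  rw [discreteDeriv, expectItems_eq_expectItems_erase_add p i, ← expectItems_sub,
    ← expectItems_mul_left]
  congr 1
  funext R
  have h_absent : insert i S ∩ R.erase i = (S ∩ R).erase i := by grind
  have h_present : insert i S ∩ insert i R = insert i (S ∩ R) := by grind
  simp only [discreteDeriv, h_absent, h_present, Finset.erase_inter, add_sub_cancel_left]

end SetValue

namespace DecisionTree

section Structure

variable {U : Type*}

/-- The decision tree that probes the items of a list whatever their states are. -/
def probeAll : List U → DecisionTree U
  | [] => .done
  | i :: l => .probe i (probeAll l) (probeAll l)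

variable [DecidableEq U]

lemma probed_probeAll (l : List U) (R : Finset U) : (probeAll l).probed R = l.toFinset := by
  induction l with
  | nil => rfl
  | cons i l ih => simp only [probeAll, probed, ih, ite_self, List.toFinset_cons]

lemma exists_feasible {I : Set (Finset U)} (hI : I.Nonempty) :
    ∃ T : DecisionTree U, T.Feasible I := by
  obtain ⟨S, hS⟩ := hI
  exact ⟨probeAll S.toList, fun R => by rwa [probed_probeAll, Finset.toList_toFinset]⟩

lemma mem_probed_congr (T : DecisionTree U) {i : U} {R R' : Finset U}
    (h : ∀ j, j ≠ i → (j ∈ R ↔ j ∈ R')) : i ∈ T.probed R ↔ i ∈ T.probed R' := by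
  induction T with
  | done => simp [probed]
  | probe j A B hA hB =>
    by_cases hj : j = i
    · simp [probed, hj]
    · by_cases hR : j ∈ R
      · simp [probed, hR, (h j hj).1 hR, hA]
      · simp [probed, hR, mt (h j hj).2 hR, hB]

end Structure

variable {U : Type*} [Fintype U] [DecidableEq U]

lemma finite_range_value (f : Finset U → ℝ) (p : U → ℝ) : (Set.range (value f p)).Finite := by
  refine (Set.finite_range fun q : Finset U → Finset U =>
    expectItems p fun R => f (q R ∩ R)).subset ?_
  rintro _ ⟨T, rfl⟩
  exact ⟨T.probed, rfl⟩

lemma expectItems_indicatorVec_probed_inter (T : DecisionTree U) (p : U → ℝ) (i : U) :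
    expectItems p (fun R => indicatorVec (T.probed R ∩ R) i) =
      p i * expectItems p fun R => indicatorVec (T.probed R) i := by
  rw [expectItems_eq_expectItems_erase_add p i, ← expectItems_mul_left]
  congr 1
  funext R
  have h : i ∈ T.probed (insert i R) ↔ i ∈ T.probed R :=
    T.mem_probed_congr fun j hj => by simp [hj]
  simp [discreteDeriv, indicatorVec, h]

lemma value_le_add_sum {f : Finset U → ℝ} (hf_mono : Monotone f) (hf_sub : Submodular f)
    {p : U → ℝ} (hp : ∀ i, p i ∈ Set.Icc (0 : ℝ) 1) (T : DecisionTree U) (Z : Finset U) :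
    T.value f p ≤ f Z + ∑ i, discreteDeriv f i Z *
      (p i * expectItems p fun R => indicatorVec (T.probed R) i) := by
  have h_pointwise (R : Finset U) : f (T.probed R ∩ R) ≤
      f Z + ∑ i, discreteDeriv f i Z * indicatorVec (T.probed R ∩ R) i :=
    calc f (T.probed R ∩ R) ≤ f (Z ∪ (T.probed R ∩ R)) := hf_mono Finset.subset_union_right
      _ ≤ f Z + ∑ i ∈ T.probed R ∩ R, discreteDeriv f i Z :=
        hf_sub.union_le_add_sum_discreteDeriv hf_mono Z _
      _ = f Z + ∑ i, discreteDeriv f i Z * indicatorVec (T.probed R ∩ R) i := by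
        simp only [indicatorVec, mul_ite, mul_one, mul_zero, Finset.sum_ite_mem,
          Finset.univ_inter]
  refine (expectItems_mono hp h_pointwise).trans_eq ?_
  simp only [expectItems_add, expectItems_const, expectItems_sum, expectItems_mul_left,
    expectItems_indicatorVec_probed_inter]

lemma value_le_setValue_add_sum {f : Finset U → ℝ} (hf_mono : Monotone f)
    (hf_sub : Submodular f) {p : U → ℝ} (hp : ∀ i, p i ∈ Set.Icc (0 : ℝ) 1)
    (T : DecisionTree U) {x : U → ℝ}
    (hx : ∀ i, expectItems p (fun R => indicatorVec (T.probed R) i) ≤ x i) (Z : Finset U) :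
    T.value f p ≤ setValue f p Z + ∑ i, x i * discreteDeriv (setValue f p) i Z := by
  have h_pointwise (R : Finset U) : T.value f p ≤
      f (Z ∩ R) + ∑ i, x i * (p i * discreteDeriv f i (Z ∩ R)) := by
    refine (value_le_add_sum hf_mono hf_sub hp T (Z ∩ R)).trans
      (add_le_add_right (Finset.sum_le_sum fun i _ => ?_) _)
    calc discreteDeriv f i (Z ∩ R) * (p i * expectItems p fun R => indicatorVec (T.probed R) i)
        ≤ discreteDeriv f i (Z ∩ R) * (p i * x i) := by
          gcongr
          exacts [discreteDeriv_nonneg hf_mono i _, (hp i).1, hx i]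
      _ = x i * (p i * discreteDeriv f i (Z ∩ R)) := by ring
  rw [← expectItems_const p (T.value f p)]
  refine (expectItems_mono hp h_pointwise).trans_eq ?_
  simp only [expectItems_add, expectItems_sum, expectItems_mul_left, discreteDeriv_setValue,
    setValue]

end DecisionTree

section AdaptivityGap

variable {U : Type*} [DecidableEq U]

lemma monotone_indicatorVec : Monotone (indicatorVec : Finset U → U → ℝ) := by
  intro S T hST i
  by_cases hi : i ∈ S
  · simp [indicatorVec, hi, hST hi]
  · simp only [indicatorVec, hi, if_false]
    split_ifs <;> simp

variable [Fintype U]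

lemma exists_mem_polytope_probed_le {I : Set (Finset U)} {p : U → ℝ}
    (hp : ∀ i, p i ∈ Set.Icc (0 : ℝ) 1) {T : DecisionTree U} (hT : T.Feasible I) :
    ∃ x ∈ polytope I, ∀ i, expectItems p (fun R => indicatorVec (T.probed R) i) ≤ x i := by
  have h_extend (R : Finset U) : ∃ M, T.probed R ⊆ M ∧ Maximal (· ∈ I) M :=
    I.toFinite.exists_le_maximal (hT R)
  choose M h_sub h_max using h_extend
  refine ⟨_, expectItems_mem_of_convex hp (convex_convexHull ℝ _)
    fun R => subset_convexHull ℝ _ ⟨M R, h_max R, rfl⟩, fun i => expectItems_mono hp fun R => ?_⟩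
  exact monotone_indicatorVec (h_sub R) i

lemma AdmitsWNR.exists_nonadaptiveValue_ge {I : Set (Finset U)} (hI : AdmitsWNR I)
    {f : Finset U → ℝ} (hf_mono : Monotone f) (hf_sub : Submodular f) {p : U → ℝ}
    (hp : ∀ i, p i ∈ Set.Icc (0 : ℝ) 1) {T : DecisionTree U} (hT : T.Feasible I) :
    ∃ w ∈ nonadaptiveValues I f p, (Real.exp 1 - 1) * T.value f p + f ∅ ≤ Real.exp 1 * w := by
  obtain ⟨x, hx, hTx⟩ := exists_mem_polytope_probed_le hp hT
  obtain ⟨D, hDI, hD, hDx⟩ := hI x hx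
  obtain rfl : (fun i => prob D {S | i ∈ S}) = x := funext hDx
  refine ⟨expect D (setValue f p), ⟨D, hDI, rfl⟩, ?_⟩
  calc (Real.exp 1 - 1) * T.value f p + f ∅
      ≤ Real.exp 1 * expectItems (fun i => prob D {S | i ∈ S}) (setValue f p) := by
        rw [← setValue_empty f p]
        exact exp_sub_one_mul_add_le_expectItems (fun i => prob_mem_Icc D _)
          (T.value_le_setValue_add_sum hf_mono hf_sub hp hTx)
    _ ≤ Real.exp 1 * expect D (setValue f p) := by
        gcongr
        exact hD.expectItems_prob_le_expect (hf_sub.setValue hp)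

lemma isGreatest_adaptiveOpt {I : Set (Finset U)} (hI : I.Nonempty) (f : Finset U → ℝ)
    (p : U → ℝ) : IsGreatest (adaptiveValues I f p) (adaptiveOpt I f p) :=
  isGreatest_sSup_expect (DecisionTree.exists_feasible hI) (DecisionTree.finite_range_value f p)

lemma isGreatest_nonadaptiveOpt {I : Set (Finset U)} (hI : I.Nonempty) (f : Finset U → ℝ)
    (p : U → ℝ) : IsGreatest (nonadaptiveValues I f p) (nonadaptiveOpt I f p) :=
  isGreatest_sSup_expect hI (Set.finite_range (setValue f p))

lemma nonadaptiveOpt_nonneg (I : Set (Finset U)) {f : Finset U → ℝ} (hf : ∀ S, 0 ≤ f S)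
    {p : U → ℝ} (hp : ∀ i, p i ∈ Set.Icc (0 : ℝ) 1) : 0 ≤ nonadaptiveOpt I f p := by
  refine Real.sSup_nonneg ?_
  rintro _ ⟨A, -, rfl⟩
  exact expect_nonneg A (setValue_nonneg hf hp)

end AdaptivityGap

end StochasticProbing

open StochasticProbing in
theorem theorem1p8_general {U : Type*} [Fintype U] [DecidableEq U]
    (I : Set (Finset U)) (hne : I.Nonempty) (hI : AdmitsWNR I)
    (f : Finset U → ℝ) (hf_nonneg : ∀ S, 0 ≤ f S) (hf_mono : Monotone f)
    (hf_sub : Submodular f) (p : U → ℝ) (hp : ∀ i, p i ∈ Set.Icc (0 : ℝ) 1) :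
    IsGreatest (adaptiveValues I f p) (adaptiveOpt I f p) ∧
    IsGreatest (nonadaptiveValues I f p) (nonadaptiveOpt I f p) ∧
    adaptiveOpt I f p ≤ Real.exp 1 / (Real.exp 1 - 1) * nonadaptiveOpt I f p ∧
    adaptivityGap I f p ≤ Real.exp 1 / (Real.exp 1 - 1) := by
  have h_ad := isGreatest_adaptiveOpt hne f p
  have h_non := isGreatest_nonadaptiveOpt hne f p
  have h_exp : 0 < Real.exp 1 - 1 := sub_pos.2 (Real.one_lt_exp_iff.2 one_pos)
  have h_tree (T : DecisionTree U) (hT : T.Feasible I) :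
      T.value f p ≤ Real.exp 1 / (Real.exp 1 - 1) * nonadaptiveOpt I f p := by
    obtain ⟨w, hw, h_le⟩ := hI.exists_nonadaptiveValue_ge hf_mono hf_sub hp hT
    have h_opt := mul_le_mul_of_nonneg_left (h_non.2 hw) (Real.exp_pos 1).le
    rw [div_mul_eq_mul_div, le_div_iff₀ h_exp]
    linarith [hf_nonneg ∅]
  have h_bound : adaptiveOpt I f p ≤ Real.exp 1 / (Real.exp 1 - 1) * nonadaptiveOpt I f p := by
    obtain ⟨A, hA, h_val⟩ := h_ad.1
    exact h_val ▸ expect_le_of_forall_le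
      (summable_toReal_mul_of_isBounded A (DecisionTree.finite_range_value f p).isBounded)
      fun T hT => h_tree T (hA T hT)
  exact ⟨h_ad, h_non, h_bound, div_le_of_le_mul₀ (nonadaptiveOpt_nonneg I hf_nonneg hp)
    (div_nonneg (Real.exp_pos 1).le h_exp.le) h_bound⟩

theorem theorem1p8 {U : Type*} [Fintype U] [DecidableEq U]
    (I : Set (Finset U)) (hne : I.Nonempty) (hdown : IsLowerSet I)
    (hI : StochasticProbing.AdmitsWNR I)
    (f : Finset U → ℝ) (hf_nonneg : ∀ S, 0 ≤ f S) (hf_mono : Monotone f)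
    (hf_sub : StochasticProbing.Submodular f)
    (p : U → ℝ) (hp : ∀ i, p i ∈ Set.Icc (0 : ℝ) 1) :
    -- optimal adaptive and non-adaptive algorithms exist
    IsGreatest (StochasticProbing.adaptiveValues I f p) (StochasticProbing.adaptiveOpt I f p) ∧
    IsGreatest (StochasticProbing.nonadaptiveValues I f p)
      (StochasticProbing.nonadaptiveOpt I f p) ∧
    -- the bound, also in the degenerate case of a zero non-adaptive optimum
    StochasticProbing.adaptiveOpt I f p ≤
      Real.exp 1 / (Real.exp 1 - 1) * StochasticProbing.nonadaptiveOpt I f p ∧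
    StochasticProbing.adaptivityGap I f p ≤ Real.exp 1 / (Real.exp 1 - 1) :=
  theorem1p8_general I hne hI f hf_nonneg hf_mono hf_sub p hp
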